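/- Let $V$ be a vertex operator algebra over $\mathbb{C}$ with vacuum vector $\mathbf 1$, conformal vector $\omega$ and rank (central charge) $c$, with $L_n=\omega_{(n+1)}$, such that $L_0$ is semisimple with finite-dimensional eigenspaces $V^n$ and $$V=\bigoplus_{n=0}^\infty V^n,\qquad V^0=\mathbb{C}\mathbf 1,\qquad V^1=0 .$$ Let $B=V^2$ be its Griess algebra, with product $ab=a_{(1)}b$ and bilinear form $(\ |\ )$ given by $(a|b)\mathbf 1=a_{(3)}b$, and let $d=\dim_{\mathbb C} B$. Let $V_\omega$ be the smallest subspace of $V$ that contains $\mathbf 1$ and is stable under all $L_n$, $n\in\mathbb Z$, and let $\mathrm{Aut}\,V$ be the group of linear automorphisms $g$ of $V$ with $g(a_{(n)}b)=(ga)_{(n)}(gb)$ for all $a,b\in V$, $n\in\mathbb Z$, and $g\omega=\omega$. Put $V^{\le n}=\bigoplus_{m=0}^nV^m$ and $V_\omega^{\le n}=V_\omega\cap V^{\le n}$. The VOA $V$ is said to be of class $\mathcal S^n$ if $\mathrm{Aut}\,V$ has no nonzero fixed vector in $V^{\le n}/V_\omega^{\le n}$. Suppose that $V$ is of class $\mathcal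 S^8$, that $$D_8(c)=c(2c-1)(3c+46)(5c+3)(5c+22)(7c+68)\neq 0,$$ and that $B$ has a real form (a real subspace $B_{\mathbb R}$ closed under the product with $B=B_{\mathbb R}\oplus iB_{\mathbb R}$) on which $(\ |\ )$ is real-valued and positive-definite. If $d\ge 2$, then $c=24$ and $d=196884$. -/

import Mathlib

/-- A vertex algebra structure on a complex vector space `V`: a linear map `a ↦ Y(a, z)` into the
vertex operators on `V` (linear maps from `V` to Laurent series with coefficients in `V`) and a
nonzero vacuum vector, subject to the vacuum axioms and the Borcherds identity. The operator
`a_(n)` is the coefficient `(Y a)[[n]]` of `z ^ (-n - 1)` in `Y(a, z)`.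

Since `a_(n) b = 0` for all sufficiently large `n`, all but finitely many terms of each of the two
sums in the Borcherds identity vanish, and `∑ᶠ` is the ordinary finite sum. -/
structure VertexAlgebra (V : Type*) [AddCommGroup V] [Module ℂ V] where
  /-- The state-field correspondence. -/
  Y : V →ₗ[ℂ] VertexOperator ℂ V
  /-- The vacuum vector. -/
  vac : V
  vac_ne_zero : vac ≠ 0
  vac_mode : ∀ (n : ℤ) (a : V),
    VertexOperator.ncoeff (Y vac) n a = if n = -1 then a else 0
  mode_vac_of_nonneg : ∀ (a : V) (n : ℤ), 0 ≤ n → VertexOperator.ncoeff (Y a) n vac = 0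
  mode_vac_neg_one : ∀ a : V, VertexOperator.ncoeff (Y a) (-1) vac = a
  borcherds : ∀ (a b v : V) (p q r : ℤ),
    ∑ᶠ i : ℕ, Ring.choose p i •
      VertexOperator.ncoeff (Y (VertexOperator.ncoeff (Y a) (r + i) b)) (p + q - i) v =
    ∑ᶠ i : ℕ, ((-1) ^ i * Ring.choose r i) •
      (VertexOperator.ncoeff (Y a) (p + r - i) (VertexOperator.ncoeff (Y b) (q + i) v) -
        (r.negOnePow : ℤ) •
          VertexOperator.ncoeff (Y b) (q + r - i) (VertexOperator.ncoeff (Y a) (p + i) v))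

namespace VertexAlgebra

variable {V : Type*} [AddCommGroup V] [Module ℂ V]

/-- The operator `a_(n)` on `V`. -/
def mode (A : VertexAlgebra V) (a : V) (n : ℤ) : Module.End ℂ V :=
  VertexOperator.ncoeff (A.Y a) n

end VertexAlgebra

/-- A vertex operator algebra over `ℂ` on the vector space `V`: a vertex algebra with a nonzero
conformal vector `ω` whose modes `L_n = ω_(n+1)` satisfy the Virasoro relations with a central
charge `c` (the rank), such that `L_{-1}` acts as the translation operator and `L_0` is semisimple
with eigenvalues in `{0, 1, 2, …}` and finite-dimensional eigenspaces. -/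
structure VertexOperatorAlgebra (V : Type*) [AddCommGroup V] [Module ℂ V] extends
    VertexAlgebra V where
  /-- The conformal vector `ω`. -/
  conf : V
  /-- The rank (central charge) `c`. -/
  rank : ℂ
  conf_ne_zero : conf ≠ 0
  virasoro : ∀ m n : ℤ,
    toVertexAlgebra.mode conf (m + 1) * toVertexAlgebra.mode conf (n + 1) -
      toVertexAlgebra.mode conf (n + 1) * toVertexAlgebra.mode conf (m + 1) =
    ((m : ℂ) - n) • toVertexAlgebra.mode conf (m + n + 1) +
      (if m + n = 0 then ((m : ℂ) ^ 3 - m) / 12 * rank else 0) • (1 : Module.End ℂ V)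
  translation : ∀ (a : V) (n : ℤ),
    toVertexAlgebra.mode (toVertexAlgebra.mode conf 0 a) n =
      -(n : ℂ) • toVertexAlgebra.mode a (n - 1)
  isInternal_eigenspace :
    DirectSum.IsInternal fun n : ℕ =>
      Module.End.eigenspace (toVertexAlgebra.mode conf 1) (n : ℂ)
  finiteDimensional_eigenspace : ∀ n : ℕ,
    FiniteDimensional ℂ (Module.End.eigenspace (toVertexAlgebra.mode conf 1) (n : ℂ))

namespace VertexOperatorAlgebra

variable {V : Type*} [AddCommGroup V] [Module ℂ V]

/-- The Virasoro operator `L_n = ω_(n+1)`. -/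
def L (A : VertexOperatorAlgebra V) (n : ℤ) : Module.End ℂ V :=
  A.mode A.conf (n + 1)

/-- The subspace `V^n` of vectors of degree `n`. -/
def homog (A : VertexOperatorAlgebra V) (n : ℕ) : Submodule ℂ V :=
  Module.End.eigenspace (A.L 0) (n : ℂ)

/-- The subspace `V^{≤ n}`, the sum of the `V^m` with `m ≤ n`. -/
def homogLE (A : VertexOperatorAlgebra V) (n : ℕ) : Submodule ℂ V :=
  ⨆ (m : ℕ) (_ : m ≤ n), A.homog m

/-- The Virasoro submodule `V_ω` generated by the vacuum vector: the smallest subspace which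
contains the vacuum vector and is stable under all `L_n`. -/
def virasoroSubmodule (A : VertexOperatorAlgebra V) : Submodule ℂ V :=
  sInf {W : Submodule ℂ V | A.vac ∈ W ∧ ∀ (n : ℤ), ∀ w ∈ W, A.L n w ∈ W}

/-- The group `Aut V` of linear automorphisms of `V` which preserve all products
`(a, b) ↦ a_(n) b` and fix the conformal vector. -/
def aut (A : VertexOperatorAlgebra V) : Subgroup (V ≃ₗ[ℂ] V) where
  carrier := {g | (∀ (a b : V) (n : ℤ), g (A.mode a n b) = A.mode (g a) n (g b)) ∧
    g A.conf = A.conf}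
  mul_mem' := by
    rintro g h ⟨hg, hg'⟩ ⟨hh, hh'⟩
    exact ⟨fun a b n => by simp [LinearEquiv.mul_apply, hg, hh], by
      simp [LinearEquiv.mul_apply, hg', hh']⟩
  one_mem' := ⟨fun _ _ _ => rfl, rfl⟩
  inv_mem' := by
    rintro g ⟨hg, hg'⟩
    refine ⟨fun a b n => ?_, ?_⟩
    · change g.symm _ = A.mode (g.symm a) n (g.symm b)
      rw [LinearEquiv.symm_apply_eq, hg]
      simp
    · change g.symm _ = _
      rw [LinearEquiv.symm_apply_eq, hg']

/-- `V` is of class `S^n`: the action of `Aut V` on the quotient `V^{≤ n} / V_ω^{≤ n}` has no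
nonzero fixed vector, where `V_ω^{≤ n} = V_ω ∩ V^{≤ n}`. The class of `v ∈ V^{≤ n}` is fixed by `g`
exactly when `g v - v ∈ V_ω`, and it is zero exactly when `v ∈ V_ω`. -/
def IsClassS (A : VertexOperatorAlgebra V) (n : ℕ) : Prop :=
  ∀ v ∈ A.homogLE n, (∀ g ∈ A.aut, g v - v ∈ A.virasoroSubmodule) → v ∈ A.virasoroSubmodule

/-- The grading condition `V^0 = ℂ 1` and `V^1 = 0`. -/
structure IsMoonshineType (A : VertexOperatorAlgebra V) : Prop where
  homog_zero : A.homog 0 = Submodule.span ℂ {A.vac}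
  homog_one : A.homog 1 = ⊥

theorem mem_homog (A : VertexOperatorAlgebra V) (n : ℕ) (v : V) :
    v ∈ A.homog n ↔ A.mode A.conf 1 v = (n : ℂ) • v :=
  Module.End.mem_eigenspace_iff

theorem mode_conf_one_mode (A : VertexOperatorAlgebra V) (a v : V) (n : ℤ) :
    A.mode A.conf 1 (A.mode a n v) =
      A.mode a n (A.mode A.conf 1 v) + A.mode (A.mode A.conf 1 a) n v -
        ((n : ℂ) + 1) • A.mode a n v := by
  have h := A.borcherds A.conf a v 1 n 0
  rw [finsum_eq_sum_of_support_subset (s := Finset.range 2),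
    finsum_eq_sum_of_support_subset (s := Finset.range 1)] at h
  · have ht := LinearMap.congr_fun (A.translation a (n + 1)) v
    simp only [VertexAlgebra.mode, Finset.sum_range_succ, Finset.sum_range_zero] at h ht ⊢
    simp [add_comm 1 n] at h ht
    rw [ht] at h
    rw [eq_comm, sub_eq_iff_eq_add] at h
    rw [h]
    module
  · intro i hi
    by_contra hi'
    rcases i with _ | i
    · simp at hi'
    · exact hi (by simp [Ring.choose_zero_succ])
  · intro i hi
    by_contra hi'
    refine hi ?_
    have : Ring.choose (1 : ℤ) i = 0 := by
      have h1 : 1 < i := by simpa using hi'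
      have := Ring.choose_natCast (R := ℤ) 1 i
      simpa [Nat.choose_eq_zero_of_lt h1] using this
    simp [this]

/-- `V^i_(n) V^j ⊆ V^{i+j-n-1}`. -/
theorem mode_mem_homog (A : VertexOperatorAlgebra V) {i j k : ℕ} {n : ℤ}
    (h : (k : ℤ) = i + j - n - 1) {a b : V} (ha : a ∈ A.homog i) (hb : b ∈ A.homog j) :
    A.mode a n b ∈ A.homog k := by
  rw [mem_homog] at ha hb ⊢
  have h' : (k : ℂ) = i + j - n - 1 := by exact_mod_cast congrArg (Int.cast (R := ℂ)) h
  have hs : A.mode ((i : ℂ) • a) n = (i : ℂ) • A.mode a n := by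
    simp [VertexAlgebra.mode]
  rw [mode_conf_one_mode, ha, hb, hs, h', map_smul, LinearMap.smul_apply]
  module

/-- The underlying space `B = V^2` of the Griess algebra. -/
abbrev Griess (A : VertexOperatorAlgebra V) : Type _ := A.homog 2

/-- The product `a b = a_(1) b` of the Griess algebra `B = V^2`. -/
def griessMul (A : VertexOperatorAlgebra V) (a b : A.Griess) : A.Griess :=
  ⟨A.mode a 1 b, A.mode_mem_homog (by norm_num) a.2 b.2⟩

theorem exists_griessForm {A : VertexOperatorAlgebra V} (hA : A.IsMoonshineType) (a b : A.Griess) :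
    ∃ z : ℂ, z • A.vac = A.mode a 3 b := by
  rw [← Submodule.mem_span_singleton, ← hA.homog_zero]
  exact A.mode_mem_homog (by norm_num) a.2 b.2

/-- The bilinear form on the Griess algebra: `(a|b)` is the scalar with `(a|b) 1 = a_(3) b`. -/
noncomputable def griessForm {A : VertexOperatorAlgebra V} (hA : A.IsMoonshineType)
    (a b : A.Griess) : ℂ :=
  (exists_griessForm hA a b).choose

theorem griessForm_smul_vac {A : VertexOperatorAlgebra V} (hA : A.IsMoonshineType)
    (a b : A.Griess) : griessForm hA a b • A.vac = A.mode a 3 b :=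
  (exists_griessForm hA a b).choose_spec

/-- A real form of the complex algebra `B`: a real subspace `R` closed under the product such that
`B = R ⊕ i R`. -/
structure IsRealForm (A : VertexOperatorAlgebra V) (R : Submodule ℝ A.Griess) : Prop where
  mul_mem : ∀ a ∈ R, ∀ b ∈ R, A.griessMul a b ∈ R
  existsUnique_add_I_smul : ∀ z : A.Griess, ∃! p : R × R,
    z = (p.1 : A.Griess) + Complex.I • (p.2 : A.Griess)

/-- The bilinear form is real-valued and positive-definite on the real subspace `R` of `B`. -/
structure IsPosDefOn {A : VertexOperatorAlgebra V} (hA : A.IsMoonshineType)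
    (R : Submodule ℝ A.Griess) : Prop where
  im_eq_zero : ∀ a ∈ R, ∀ b ∈ R, (griessForm hA a b).im = 0
  re_pos : ∀ a ∈ R, a ≠ 0 → 0 < (griessForm hA a a).re

end VertexOperatorAlgebra

/-- The polynomial `D_8(c)`, whose zeros are the central charges `c` for which the Virasoro module
`M(c,0) / M(c,1)` has a singular vector of weight at most `8`. -/
def kacD8 (c : ℂ) : ℂ :=
  c * (2 * c - 1) * (3 * c + 46) * (5 * c + 3) * (5 * c + 22) * (7 * c + 68)

/-! ### Grading, Virasoro operators and primary vectors of weight two -/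

namespace VertexOperatorAlgebra

variable {V : Type*} [AddCommGroup V] [Module ℂ V]

/-! The proof evaluates a traced four-point function in two ways. Let `x_i`, `y_i` be dual bases of
the orthogonal complement of `ω` in `B`, which consists of primary vectors; there are `n = d - 1` of
them. The vectors `∑ (x_i)_(3-m) y_i` of weight `m` (`pairSum`) are invariant under `Aut V`, so for
`m ≤ 8` class `S^8` puts them in the Virasoro submodule.

There everything is governed by the Virasoro relations. Fix a primary `u` with `(u|u) ≠ 0`. Lowering
the pair sum to the vacuum by a word `μ` gives the factor `chi μ` (`lower_pairSum`), and the
functional `v ↦ u_(3) u_(m-1) v` takes a word `w` to `chi w` times `u_(3) u`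
(`IsPrimaryTwo.mode_mode_word`). Expressing this functional through lowering operators amounts to
solving a Gram system in the vacuum module; `cert` gives the solution multiplied by `D_8(c)`, and
`check_cert` verifies it. Hence `D_8(c) u_(3) u_(m-1) ∑ (x_i)_(3-m) y_i` is an explicit polynomial
in `c` times `n (u|u) 1`.

Locality of order four of `u` and `x_i` relates these numbers for different `m` to `∑ u_(3)
(x_i)_(-1) u_(3) y_i`, which duality evaluates as `(u|u) 1`. Two instances give two equations for
`n` and `c` (`locality_relations`). Eliminating `D_8(c)` leaves `(c - 24)(5c - 142) = 0` once
positivity has made `c` a positive real; `c = 142/5` would make `n` negative, and `c = 24` gives `n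
= 196883`. -/

/-- Eigenspaces for distinct eigenvalues are independent, and those for natural numbers already span
`V`, so no room is left for another eigenvalue. -/
theorem eq_zero_of_L_zero_eq (A : VertexOperatorAlgebra V) {v : V} {z : ℂ}
    (hv : A.L 0 v = z • v) (hz : ∀ n : ℕ, z ≠ n) : v = 0 := by
  have h := Module.End.eigenspaces_iSupIndep (A.L 0) z
  have htop : (⨆ (μ : ℂ) (_ : μ ≠ z), Module.End.eigenspace (A.L 0) μ) = ⊤ := by
    rw [eq_top_iff, ← A.isInternal_eigenspace.submodule_iSup_eq_top]
    exact iSup_le fun n => le_iSup₂_of_le (n : ℂ) (hz n).symm le_rfl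
  rw [htop, disjoint_top] at h
  have : v ∈ Module.End.eigenspace (A.L 0) z := Module.End.mem_eigenspace_iff.mpr hv
  rwa [h, Submodule.mem_bot] at this

theorem L_apply (A : VertexOperatorAlgebra V) (n : ℤ) (v : V) :
    A.L n v = A.mode A.conf (n + 1) v := rfl

theorem mem_homog_iff (A : VertexOperatorAlgebra V) (n : ℕ) (v : V) :
    v ∈ A.homog n ↔ A.L 0 v = (n : ℂ) • v :=
  Module.End.mem_eigenspace_iff

theorem iSupIndep_homog (A : VertexOperatorAlgebra V) : iSupIndep A.homog :=
  (Module.End.eigenspaces_iSupIndep (A.L 0)).comp Nat.cast_injective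

/-- `V^i_(n) V^j` vanishes if its weight would be negative. -/
theorem mode_eq_zero (A : VertexOperatorAlgebra V) {i j : ℕ} {n : ℤ}
    (h : (i : ℤ) + j - n - 1 < 0) {a b : V} (ha : a ∈ A.homog i) (hb : b ∈ A.homog j) :
    A.mode a n b = 0 := by
  rw [mem_homog] at ha hb
  have hs : A.mode ((i : ℂ) • a) n = (i : ℂ) • A.mode a n := by
    simp [VertexAlgebra.mode]
  refine A.eq_zero_of_L_zero_eq (z := ((i : ℤ) + j - n - 1 : ℤ)) ?_ fun k hk => ?_
  · change A.mode A.conf 1 _ = _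
    rw [mode_conf_one_mode, ha, hb, hs, map_smul, LinearMap.smul_apply]
    push_cast
    module
  · have : ((i : ℤ) + j - n - 1 : ℤ) = (k : ℤ) := by exact_mod_cast hk
    omega

theorem L_comm_apply (A : VertexOperatorAlgebra V) (m n : ℤ) (v : V) :
    A.L m (A.L n v) = A.L n (A.L m v) + ((m : ℂ) - n) • A.L (m + n) v +
      (if m + n = 0 then ((m : ℂ) ^ 3 - m) / 12 * A.rank else 0) • v := by
  have h := LinearMap.congr_fun (A.virasoro m n) v
  simp only [LinearMap.sub_apply, Module.End.mul_apply, LinearMap.add_apply, LinearMap.smul_apply,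
    Module.End.one_apply] at h
  rw [sub_eq_iff_eq_add] at h
  rw [L_apply, L_apply, h]
  simp only [L_apply]
  abel

theorem L_vac (A : VertexOperatorAlgebra V) {n : ℤ} (hn : -1 ≤ n) : A.L n A.vac = 0 :=
  A.mode_vac_of_nonneg _ _ (by omega)

theorem L_neg_two_vac (A : VertexOperatorAlgebra V) : A.L (-2) A.vac = A.conf :=
  A.mode_vac_neg_one _

theorem vac_mem_homog (A : VertexOperatorAlgebra V) : A.vac ∈ A.homog 0 := by
  rw [mem_homog_iff, A.L_vac (by norm_num)]
  simp

theorem conf_mem_homog (A : VertexOperatorAlgebra V) : A.conf ∈ A.homog 2 := by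
  rw [mem_homog_iff, ← L_neg_two_vac, L_comm_apply, A.L_vac (by norm_num)]
  simp

theorem L_mem_homog (A : VertexOperatorAlgebra V) {n : ℤ} {i j : ℕ} (h : (j : ℤ) = i - n) {v : V}
    (hv : v ∈ A.homog i) : A.L n v ∈ A.homog j :=
  A.mode_mem_homog (by push_cast; omega) A.conf_mem_homog hv

theorem L_eq_zero (A : VertexOperatorAlgebra V) {n : ℤ} {i : ℕ} (h : (i : ℤ) < n) {v : V}
    (hv : v ∈ A.homog i) : A.L n v = 0 :=
  A.mode_eq_zero (by push_cast; omega) A.conf_mem_homog hv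

/-- `L_2 ω = (c / 2) 1`. -/
theorem L_two_conf (A : VertexOperatorAlgebra V) : A.L 2 A.conf = (A.rank / 2) • A.vac := by
  rw [← L_neg_two_vac, L_comm_apply, A.L_vac (by norm_num)]
  norm_num [A.L_vac]
  congr 1
  ring

/-- The primary vectors of weight two. -/
structure IsPrimaryTwo (A : VertexOperatorAlgebra V) (x : V) : Prop where
  mem_homog : x ∈ A.homog 2
  L_one : A.L 1 x = 0
  L_two : A.L 2 x = 0

namespace IsPrimaryTwo

variable {A : VertexOperatorAlgebra V} {x y : V}

theorem L_pos (hx : A.IsPrimaryTwo x) {n : ℤ} (hn : 1 ≤ n) : A.L n x = 0 := by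
  obtain rfl | rfl | h : n = 1 ∨ n = 2 ∨ (2 : ℕ) < n := by push_cast; omega
  · exact hx.L_one
  · exact hx.L_two
  · exact A.L_eq_zero h hx.mem_homog

/-- `[L_n, x_(k)] = (n + 1 - k) x_(n+k)` for a primary vector `x` of weight two. -/
theorem L_mode (hx : A.IsPrimaryTwo x) (n k : ℤ) (v : V) :
    A.L n (A.mode x k v) = A.mode x k (A.L n v) + ((n : ℂ) + 1 - k) • A.mode x (n + k) v := by
  -- With `r = 0` this is the commutator formula. Only `ω_(0) x` and `ω_(1) x = 2x` contribute;
  -- translation turns the former into `-(n + 1 + k) x_(n+k)`.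
  have h := A.borcherds A.conf x v (n + 1) k 0
  rw [finsum_eq_sum_of_support_subset (s := Finset.range 2),
    finsum_eq_sum_of_support_subset (s := Finset.range 1)] at h
  · have ht := LinearMap.congr_fun (A.translation x (n + 1 + k)) v
    have h0 : A.mode A.conf 1 x = (2 : ℂ) • x := by
      simpa using (A.mem_homog 2 x).mp hx.mem_homog
    have e : n + 1 + k - 1 = n + k := by ring
    simp only [VertexAlgebra.mode, Finset.sum_range_succ, Finset.sum_range_zero, L_apply] at h ht h0 ⊢
    simp [e, h0] at h ht
    rw [ht] at h
    rw [eq_comm, sub_eq_iff_eq_add] at h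
    rw [h, ← Int.cast_smul_eq_zsmul ℂ]
    push_cast
    module
  · intro i hi
    by_contra hi'
    rcases i with _ | i
    · simp at hi'
    · exact hi (by simp [Ring.choose_zero_succ])
  · intro i hi
    by_contra hi'
    have h2 : 1 < i := by simpa using hi'
    have h3 : VertexOperator.ncoeff (A.Y A.conf) i x = 0 := by
      have := hx.L_pos (n := (i : ℤ) - 1) (by omega)
      rw [L_apply, sub_add_cancel] at this
      exact this
    exact hi (by simp [h3])

end IsPrimaryTwo

/-- Locality of order four of two vectors of weight two. -/
theorem locality (A : VertexOperatorAlgebra V) {a b : V} (ha : a ∈ A.homog 2) (hb : b ∈ A.homog 2)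
    (p q : ℤ) (v : V) :
    ∑ i ∈ Finset.range 5, ((-1) ^ i * (Nat.choose 4 i : ℤ)) •
      (A.mode a (p + 4 - i) (A.mode b (q + i) v) -
        A.mode b (q + 4 - i) (A.mode a (p + i) v)) = 0 := by
  -- The left side vanishes because `a_(4+i) b` has negative weight.
  have h := A.borcherds a b v p q 4
  have hc : ∀ i : ℕ, Ring.choose (4 : ℤ) i = (Nat.choose 4 i : ℤ) := fun i => by
    have := Ring.choose_natCast (R := ℤ) 4 i
    simpa using this
  rw [finsum_eq_zero_of_forall_eq_zero, finsum_eq_sum_of_support_subset (s := Finset.range 5)] at h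
  · simp only [hc] at h
    rw [h]
    refine Finset.sum_congr rfl fun i _ => ?_
    rw [show Int.negOnePow 4 = 1 from Int.negOnePow_even 4 (by decide)]
    simp [VertexAlgebra.mode]
  · intro i hi
    by_contra hi'
    exact hi (by simp [hc, Nat.choose_eq_zero_of_lt (show 4 < i by simp at hi'; omega)])
  · intro i
    have : VertexOperator.ncoeff (A.Y a) (4 + i) b = 0 :=
      A.mode_eq_zero (by push_cast; omega) ha hb
    simp [this]

/-- Symmetry of the third product of vectors of weight two. -/
theorem mode_three_comm (A : VertexOperatorAlgebra V) {a b : V} (ha : a ∈ A.homog 2)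
    (hb : b ∈ A.homog 2) : A.mode a 3 b = A.mode b 3 a := by
  -- On the vacuum the left side reduces to `(a_(3) b)_(-1) 1`, and on the right only `b_(3) a_(-1)
  -- 1` survives; the odd `r` makes its sign positive.
  have h := A.borcherds a b A.vac (-1) 0 3
  rw [finsum_eq_single _ 0, finsum_eq_single _ 0] at h
  · have h1 := A.mode_vac_neg_one (VertexOperator.ncoeff (A.Y a) 3 b)
    have h2 := A.mode_vac_of_nonneg b 0 le_rfl
    have h3 := A.mode_vac_neg_one a
    have h4 : Int.negOnePow 3 = -1 := Int.negOnePow_odd 3 (by decide)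
    simp only [VertexAlgebra.mode]
    simpa [h1, h2, h3, h4] using h
  · intro i hi
    have h2 := A.mode_vac_of_nonneg b (0 + i) (by omega)
    have h3 := A.mode_vac_of_nonneg a (-1 + i) (by omega)
    simp only [h2, h3, map_zero, smul_zero, sub_zero]
  · intro i hi
    have : VertexOperator.ncoeff (A.Y a) (3 + i) b = 0 :=
      A.mode_eq_zero (by push_cast; omega) ha hb
    simp [this]

end VertexOperatorAlgebra

/-! ### Polynomials as lists of integer coefficients -/

namespace IntPoly

/-- The value at `h` of the polynomial with the given list of coefficients. -/
noncomputable def eval (h : ℂ) : List ℤ → ℂ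
  | [] => 0
  | a :: p => a + h * eval h p

/-- Sum of polynomials. -/
def add : List ℤ → List ℤ → List ℤ
  | [], q => q
  | a :: p, [] => a :: p
  | a :: p, b :: q => (a + b) :: add p q

/-- Integer multiple of a polynomial. -/
def smul (z : ℤ) (p : List ℤ) : List ℤ := p.map (z * ·)

/-- Product of polynomials. -/
def mul : List ℤ → List ℤ → List ℤ
  | [], _ => []
  | a :: p, q => add (smul a q) (0 :: mul p q)

/-- Sum of a list of polynomials. -/
def sum (l : List (List ℤ)) : List ℤ := l.foldr add []

@[simp] theorem eval_nil (h : ℂ) : eval h [] = 0 := rfl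

@[simp] theorem eval_cons (h : ℂ) (a : ℤ) (p : List ℤ) : eval h (a :: p) = a + h * eval h p := rfl

@[simp] theorem eval_add (h : ℂ) (p q : List ℤ) : eval h (add p q) = eval h p + eval h q := by
  fun_induction add p q <;> simp_all
  ring

@[simp] theorem eval_smul (h : ℂ) (z : ℤ) (p : List ℤ) : eval h (smul z p) = z * eval h p := by
  induction p with
  | nil => simp [smul]
  | cons a p ih =>
    simp only [smul, List.map_cons, eval_cons] at ih ⊢
    rw [ih]
    push_cast
    ring

@[simp] theorem eval_mul (h : ℂ) (p q : List ℤ) : eval h (mul p q) = eval h p * eval h q := by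
  fun_induction mul p q <;> simp_all
  ring

theorem eval_sum (h : ℂ) (l : List (List ℤ)) : eval h (sum l) = (l.map (eval h)).sum := by
  induction l with
  | nil => rfl
  | cons p l ih => simp only [sum, List.foldr_cons, eval_add, List.map_cons, List.sum_cons] at ih ⊢
                   rw [ih]

theorem eval_eq_zero (h : ℂ) {p : List ℤ} (hp : ∀ a ∈ p, a = 0) : eval h p = 0 := by
  induction p with
  | nil => rfl
  | cons a p ih => simp [hp a (by simp), ih fun b hb => hp b (by simp [hb])]

end IntPoly

/-! ### Symbolic calculus in the vacuum Virasoro module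

A word `[a₁, …, aₖ]` stands for `L_{-a₁} ⋯ L_{-aₖ} 1`, and a list of pairs of a polynomial in half
the central charge and a word stands for a linear combination. -/

namespace VirasoroWord

/-- The words of weight `m` with all letters at least two. -/
def IsWord (m : ℕ) (w : List ℕ) : Prop := (∀ a ∈ w, 2 ≤ a) ∧ w.sum = m

/-- `L_n` applied to a word, as a linear combination of words. -/
def act (n : ℤ) : List ℕ → List (List ℤ × List ℕ)
  | [] => if n ≤ -2 then [([1], [n.natAbs])] else []
  | a :: w => if n ≤ -2 then [([1], n.natAbs :: a :: w)] else
      (act n w).map (fun t => (t.1, a :: t.2)) ++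
      ((act (n - a) w).map (fun t => (IntPoly.smul (n + a) t.1, t.2)) ++
        if n = a then [([0, (n ^ 3 - n) / 6], w)] else [])

/-- `L_{nₖ} ⋯ L_{n₁}` applied to a linear combination of words. -/
def run : List ℕ → List (List ℤ × List ℕ) → List (List ℤ × List ℕ)
  | [], ts => ts
  | n :: μ, ts => run μ (ts.flatMap fun t => (act n t.2).map fun s => (IntPoly.mul t.1 s.1, s.2))

/-- The numbers determined by `chi (a :: w) = (m + a - 2) chi w`, where `m` is the weight of the
word `a :: w`. -/
def chi : List ℕ → ℤ
  | [] => 1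
  | a :: w => (2 * a + w.sum - 2) * chi w

/-- All words of weight `m` with all letters at least two, if `m` is at most the first argument. -/
def words : ℕ → ℕ → List (List ℕ)
  | _, 0 => [[]]
  | 0, _ + 1 => []
  | k + 1, m + 1 => (List.range (m + 2)).flatMap fun a =>
      if 2 ≤ a then (words k (m + 1 - a)).map (a :: ·) else []

/-- The operator `∑ p_μ L_μ` given by the list `X` of pairs `(p_μ, μ)` takes every word `w` of
weight `m` to `D chi w` times the vacuum vector. -/
def check (D : List ℤ) (m : ℕ) (X : List (List ℤ × List ℕ)) : Bool :=
  X.all (fun x => x.2.all (2 ≤ ·) && x.2.sum == m) && (words m m).all fun w =>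
    (X.all fun x => (run x.2 [([1], w)]).all fun t => t.2 == []) &&
    (IntPoly.add (IntPoly.smul (-chi w) D) (IntPoly.sum (X.map fun x =>
      IntPoly.mul x.1 (IntPoly.sum ((run x.2 [([1], w)]).map Prod.fst))))).all (· == 0)

theorem isWord_of_check {D : List ℤ} {m : ℕ} {X : List (List ℤ × List ℕ)} (hX : check D m X = true)
    {x : List ℤ × List ℕ} (hx : x ∈ X) : IsWord m x.2 := by
  simp only [check, Bool.and_eq_true, List.all_eq_true, beq_iff_eq, decide_eq_true_eq] at hX
  exact hX.1 x hx

theorem mem_words {k m : ℕ} (hk : m ≤ k) {w : List ℕ} (hw : IsWord m w) : w ∈ words k m := by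
  induction w generalizing k m with
  | nil =>
    obtain rfl : m = 0 := by simpa using hw.2.symm
    simp [words]
  | cons a w ih =>
    have ha : 2 ≤ a := hw.1 a (by simp)
    have hs : a + w.sum = m := by simpa using hw.2
    obtain ⟨m, rfl⟩ : ∃ m', m = m' + 1 := ⟨m - 1, by omega⟩
    obtain ⟨k, rfl⟩ : ∃ k', k = k' + 1 := ⟨k - 1, by omega⟩
    simp only [words, List.mem_flatMap, List.mem_range]
    refine ⟨a, by omega, ?_⟩
    rw [if_pos ha, List.mem_map]
    exact ⟨w, ih (by omega) ⟨fun b hb => hw.1 b (by simp [hb]), by omega⟩, rfl⟩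

end VirasoroWord

/-! ### Soundness of the symbolic calculus and the graded pieces of the Virasoro submodule -/

namespace VertexOperatorAlgebra

open VirasoroWord

variable {V : Type*} [AddCommGroup V] [Module ℂ V] (A : VertexOperatorAlgebra V)

/-- The vector `L_{-a₁} ⋯ L_{-aₖ} 1`. -/
def word : List ℕ → V
  | [] => A.vac
  | a :: w => A.L (-a) (word w)

/-- The operator `L_{nₖ} ⋯ L_{n₁}`. -/
def lower : List ℕ → Module.End ℂ V
  | [] => 1
  | n :: μ => lower μ * A.L n

/-- The linear combination of words denoted by a list. -/
noncomputable def interp (ts : List (List ℤ × List ℕ)) : V :=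
  (ts.map fun t => IntPoly.eval (A.rank / 2) t.1 • A.word t.2).sum

theorem word_mem_homog (w : List ℕ) : A.word w ∈ A.homog w.sum := by
  induction w with
  | nil => exact A.vac_mem_homog
  | cons a w ih => exact A.L_mem_homog (by simp; ring) ih

@[simp] theorem interp_nil : A.interp [] = 0 := rfl

@[simp] theorem interp_cons (t : List ℤ × List ℕ) (ts : List (List ℤ × List ℕ)) :
    A.interp (t :: ts) = IntPoly.eval (A.rank / 2) t.1 • A.word t.2 + A.interp ts := by
  simp [interp]

@[simp] theorem interp_append (ts us : List (List ℤ × List ℕ)) :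
    A.interp (ts ++ us) = A.interp ts + A.interp us := by
  simp [interp]

theorem interp_map_cons (a : ℕ) (ts : List (List ℤ × List ℕ)) :
    A.interp (ts.map fun t => (t.1, a :: t.2)) = A.L (-a) (A.interp ts) := by
  induction ts with
  | nil => simp
  | cons t ts ih => simp [ih, word]

theorem interp_map_smul (z : ℤ) (ts : List (List ℤ × List ℕ)) :
    A.interp (ts.map fun t => (IntPoly.smul z t.1, t.2)) = (z : ℂ) • A.interp ts := by
  induction ts with
  | nil => simp
  | cons t ts ih => simp [ih, mul_smul]

theorem interp_map_mul (p : List ℤ) (ts : List (List ℤ × List ℕ)) :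
    A.interp (ts.map fun t => (IntPoly.mul p t.1, t.2)) =
      IntPoly.eval (A.rank / 2) p • A.interp ts := by
  induction ts with
  | nil => simp
  | cons t ts ih => simp [ih, mul_smul]

theorem interp_act (n : ℤ) (w : List ℕ) : A.interp (act n w) = A.L n (A.word w) := by
  have hlow : ∀ (w : List ℕ) (n : ℤ), n ≤ -2 →
      A.interp [([1], n.natAbs :: w)] = A.L n (A.word w) := fun w n hn => by
    have : (-n.natAbs : ℤ) = n := by omega
    rw [interp_cons, interp_nil, word, this]
    simp
  induction w generalizing n with
  | nil =>
    by_cases hn : n ≤ -2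
    · rw [act, if_pos hn, hlow _ _ hn]
    · rw [act, if_neg hn, interp_nil, word, A.L_vac (by omega)]
  | cons a w ih =>
    by_cases hn : n ≤ -2
    · rw [act, if_pos hn, hlow _ _ hn]
    · rw [act, if_neg hn, interp_append, interp_append, interp_map_cons, interp_map_smul, ih, ih,
        word, A.L_comm_apply n (-a), ← sub_eq_add_neg n (a : ℤ), add_assoc]
      congr 2
      · push_cast
        ring_nf
      · simp only [sub_eq_zero]
        split_ifs with h
        -- The central term is `(n ^ 3 - n) / 6` times half the central charge; this divisibility is
        -- why `c / 2` is the variable of the integer polynomials.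
        · have h6 : (6 : ℤ) ∣ n ^ 3 - n := by
            refine (ZMod.intCast_zmod_eq_zero_iff_dvd _ 6).mp ?_
            push_cast
            generalize (n : ZMod 6) = x
            revert x
            decide
          have h6' : (((n ^ 3 - n) / 6 : ℤ) : ℂ) = ((n : ℂ) ^ 3 - n) / 6 := by
            rw [Int.cast_div h6 (by norm_num)]
            push_cast
            rfl
          simp only [interp_cons, interp_nil, IntPoly.eval_cons, IntPoly.eval_nil, h6']
          rw [add_zero]
          congr 1
          push_cast
          ring
        · simp

theorem interp_run (μ : List ℕ) (ts : List (List ℤ × List ℕ)) :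
    A.interp (run μ ts) = A.lower μ (A.interp ts) := by
  induction μ generalizing ts with
  | nil => simp [run, lower]
  | cons n μ ih =>
    rw [run, ih, lower, Module.End.mul_apply]
    congr 1
    induction ts with
    | nil => simp
    | cons t ts iht =>
      rw [List.flatMap_cons, interp_append, iht, interp_map_mul, interp_act]
      simp

theorem interp_of_forall_eq_nil {ts : List (List ℤ × List ℕ)} (h : ∀ t ∈ ts, t.2 = []) :
    A.interp ts = IntPoly.eval (A.rank / 2) (IntPoly.sum (ts.map Prod.fst)) • A.vac := by
  induction ts with
  | nil => simp [IntPoly.sum]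
  | cons t ts ih =>
    rw [interp_cons, ih fun s hs => h s (by simp [hs]), h t (by simp), word, ← add_smul]
    simp [IntPoly.eval_sum]

/-- The operator `∑ p_μ L_μ` given by the list `X` of pairs `(p_μ, μ)`. -/
noncomputable def lowerSum (X : List (List ℤ × List ℕ)) : Module.End ℂ V :=
  (X.map fun x => IntPoly.eval (A.rank / 2) x.1 • A.lower x.2).sum

theorem lowerSum_apply (X : List (List ℤ × List ℕ)) (v : V) :
    A.lowerSum X v = (X.map fun x => IntPoly.eval (A.rank / 2) x.1 • A.lower x.2 v).sum := by
  induction X with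
  | nil => simp [lowerSum]
  | cons x X ih => simpa [lowerSum] using ih

/-- Soundness of `check`: all its lowered words are empty, and the vanishing coefficient list is the
desired identity evaluated at `c / 2`. -/
theorem lowerSum_word {D : List ℤ} {m : ℕ} {X : List (List ℤ × List ℕ)}
    (hX : check D m X = true) {w : List ℕ} (hw : IsWord m w) :
    A.lowerSum X (A.word w) = (IntPoly.eval (A.rank / 2) D * chi w) • A.vac := by
  simp only [check, Bool.and_eq_true, List.all_eq_true, beq_iff_eq] at hX
  obtain ⟨h1, h2⟩ := hX.2 w (mem_words le_rfl hw)
  have h3 := IntPoly.eval_eq_zero (A.rank / 2) h2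
  have h4 : ∀ x ∈ X, IntPoly.eval (A.rank / 2) x.1 • A.lower x.2 (A.word w) =
      IntPoly.eval (A.rank / 2) (IntPoly.mul x.1 (IntPoly.sum ((run x.2 [([1], w)]).map Prod.fst)))
        • A.vac := fun x hx => by
    rw [IntPoly.eval_mul, mul_smul, ← A.interp_of_forall_eq_nil (h1 x hx), interp_run]
    simp
  rw [lowerSum_apply, List.map_congr_left h4, eq_comm]
  rw [IntPoly.eval_add, IntPoly.eval_smul, IntPoly.eval_sum, add_comm, add_eq_zero_iff_eq_neg] at h3
  have h5 : (IntPoly.eval (A.rank / 2) D * chi w) = -((-chi w : ℤ) * IntPoly.eval (A.rank / 2) D) := by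
    push_cast
    ring
  rw [h5, ← h3, List.map_map]
  generalize X = Y
  induction Y with
  | nil => simp
  | cons y Y ih => simpa [add_smul] using ih

/-- The part of weight `m` of the Virasoro submodule generated by the vacuum vector. -/
def wordSpan (m : ℕ) : Submodule ℂ V := Submodule.span ℂ {v | ∃ w, IsWord m w ∧ A.word w = v}

theorem wordSpan_le_homog (m : ℕ) : A.wordSpan m ≤ A.homog m := by
  refine Submodule.span_le.mpr ?_
  rintro _ ⟨w, hw, rfl⟩
  exact hw.2 ▸ A.word_mem_homog w

/-- For `n ≤ -2` a letter is prepended; otherwise `L_n` is commuted to the right until it kills the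
vacuum, each commutator acting on a shorter word. -/
theorem L_mem_iSup_wordSpan (n : ℤ) {v : V} (hv : v ∈ ⨆ m, A.wordSpan m) :
    A.L n v ∈ ⨆ m, A.wordSpan m := by
  have hword : ∀ w : List ℕ, (∀ a ∈ w, 2 ≤ a) → A.word w ∈ ⨆ m, A.wordSpan m := fun w hw =>
    Submodule.mem_iSup_of_mem w.sum (Submodule.subset_span ⟨w, ⟨hw, rfl⟩, rfl⟩)
  have hlow : ∀ n : ℤ, n ≤ -2 → ∀ v ∈ ⨆ m, A.wordSpan m, A.L n v ∈ ⨆ m, A.wordSpan m := by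
    intro n hn v hv
    suffices h : (⨆ m, A.wordSpan m) ≤ (⨆ m, A.wordSpan m).comap (A.L n) from h hv
    refine iSup_le fun m => Submodule.span_le.mpr ?_
    rintro _ ⟨w, hw, rfl⟩
    have := hword (n.natAbs :: w) (by
      intro a ha
      rcases List.mem_cons.mp ha with rfl | ha
      · omega
      · exact hw.1 a ha)
    rwa [word, show (-n.natAbs : ℤ) = n by omega] at this
  have key : ∀ (w : List ℕ), (∀ a ∈ w, 2 ≤ a) → ∀ n : ℤ, A.L n (A.word w) ∈ ⨆ m, A.wordSpan m := by
    intro w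
    induction w with
    | nil =>
      intro hw n
      by_cases hn : n ≤ -2
      · exact hlow n hn _ (hword [] (by simp))
      · rw [word, A.L_vac (by omega)]
        exact zero_mem _
    | cons a w ih =>
      intro hw n
      have ha : 2 ≤ a := hw a (by simp)
      have hw' : ∀ b ∈ w, 2 ≤ b := fun b hb => hw b (by simp [hb])
      rw [word, L_comm_apply]
      exact add_mem (add_mem (hlow _ (by omega) _ (ih hw' n)) (Submodule.smul_mem _ _ (ih hw' _)))
        (Submodule.smul_mem _ _ (hword w hw'))
  suffices h : (⨆ m, A.wordSpan m) ≤ (⨆ m, A.wordSpan m).comap (A.L n) from h hv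
  refine iSup_le fun m => Submodule.span_le.mpr ?_
  rintro _ ⟨w, hw, rfl⟩
  exact key w hw.1 n

theorem virasoroSubmodule_le : A.virasoroSubmodule ≤ ⨆ m, A.wordSpan m :=
  sInf_le ⟨Submodule.mem_iSup_of_mem 0 (Submodule.subset_span ⟨[], ⟨by simp, rfl⟩, rfl⟩),
    fun n _ hw => A.L_mem_iSup_wordSpan n hw⟩

/-- Splitting off the weight `m` part leaves a remainder that lies both in `V^m` and in the sum of
the other weights, hence is zero. -/
theorem mem_wordSpan_of_mem_homog {m : ℕ} {v : V} (hv : v ∈ A.virasoroSubmodule)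
    (hm : v ∈ A.homog m) : v ∈ A.wordSpan m := by
  have h := A.virasoroSubmodule_le hv
  rw [iSup_split_single _ m] at h
  obtain ⟨y, hy, z, hz, rfl⟩ := Submodule.mem_sup.mp h
  have hz' : z ∈ ⨆ (i : ℕ) (_ : i ≠ m), A.homog i :=
    (iSup₂_mono fun i _ => A.wordSpan_le_homog i) hz
  have hz'' : z ∈ A.homog m := by simpa using sub_mem hm (A.wordSpan_le_homog m hy)
  have h0 : z = 0 := (Submodule.disjoint_def.mp (A.iSupIndep_homog m)) z hz'' hz'
  simpa [h0] using hy

end VertexOperatorAlgebra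

namespace VertexOperatorAlgebra

open VirasoroWord

variable {V : Type*} [AddCommGroup V] [Module ℂ V] {A : VertexOperatorAlgebra V}

/-! ### Sums of products over dual families of primary vectors -/

/-- The vector `∑ (x_i)_(3-m) y_i` of weight `m`, for families of vectors of weight two. -/
def pairSum (A : VertexOperatorAlgebra V) {ι : Type*} [Fintype ι] (x y : ι → V) (m : ℕ) : V :=
  ∑ i, A.mode (x i) (3 - m) (y i)

section pairSum

variable {ι : Type*} [Fintype ι] {x y : ι → V}

theorem pairSum_mem_homog (hx : ∀ i, A.IsPrimaryTwo (x i)) (hy : ∀ i, A.IsPrimaryTwo (y i))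
    (m : ℕ) : A.pairSum x y m ∈ A.homog m :=
  sum_mem fun i _ => A.mode_mem_homog (by push_cast; ring) (hx i).mem_homog (hy i).mem_homog

/-- `L_n` annihilates `y_i`, so only its commutator with the mode of `x_i` remains. The factor is
the one in the recursion for `chi`. -/
theorem L_pairSum (hx : ∀ i, A.IsPrimaryTwo (x i)) (hy : ∀ i, A.IsPrimaryTwo (y i))
    {n : ℕ} (hn : 1 ≤ n) (m : ℕ) :
    A.L n (A.pairSum x y (n + m)) = (2 * n + m - 2 : ℂ) • A.pairSum x y m := by
  simp only [pairSum, map_sum, Finset.smul_sum]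
  refine Finset.sum_congr rfl fun i _ => ?_
  rw [(hx i).L_mode, (hy i).L_pos (by exact_mod_cast hn), map_zero, zero_add]
  congr 1
  · push_cast
    ring
  · congr 2
    push_cast
    ring

theorem lower_pairSum (hx : ∀ i, A.IsPrimaryTwo (x i)) (hy : ∀ i, A.IsPrimaryTwo (y i))
    {m : ℕ} {μ : List ℕ} (hμ : IsWord m μ) :
    A.lower μ (A.pairSum x y m) = (chi μ : ℂ) • A.pairSum x y 0 := by
  induction μ generalizing m with
  | nil =>
    obtain rfl : m = 0 := by simpa using hμ.2.symm
    simp [lower, chi]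
  | cons n μ ih =>
    obtain rfl : n + μ.sum = m := by simpa using hμ.2
    have hn : 2 ≤ n := hμ.1 n (by simp)
    rw [lower, Module.End.mul_apply, L_pairSum hx hy (by omega), map_smul,
      ih ⟨fun a ha => hμ.1 a (by simp [ha]), rfl⟩, smul_smul, chi]
    simp only [Int.cast_mul, Int.cast_sub, Int.cast_add, Int.cast_ofNat, Int.cast_natCast]

end pairSum

theorem mem_span_vac (hA : A.IsMoonshineType) {v : V} (hv : v ∈ A.homog 0) :
    ∃ z : ℂ, z • A.vac = v := by
  rwa [hA.homog_zero, Submodule.mem_span_singleton] at hv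

/-- The inner vector has weight `2 - a`. It vanishes for `a > 2`; for `a = 2` it is a multiple of
the vacuum, which `L_{-2}` sends to a multiple of `ω`, orthogonal to the primary `u`. -/
theorem IsPrimaryTwo.mode_three_L_neg (hA : A.IsMoonshineType) {u : V} (hu : A.IsPrimaryTwo u)
    {a l : ℕ} (ha : 2 ≤ a) {n : ℤ} (hn : (l : ℤ) - n + 1 = 2 - a) {v : V}
    (hv : v ∈ A.homog l) : A.mode u 3 (A.L (-a) (A.mode u n v)) = 0 := by
  obtain rfl | ha := ha.eq_or_lt
  · obtain ⟨z, hz⟩ := mem_span_vac hA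
      (A.mode_mem_homog (i := 2) (k := 0) (j := l) (n := n) (by push_cast at hn ⊢; omega)
        hu.mem_homog hv)
    rw [← hz, map_smul, Nat.cast_ofNat, L_neg_two_vac, map_smul,
      A.mode_three_comm hu.mem_homog A.conf_mem_homog]
    have := hu.L_two
    rw [L_apply] at this
    norm_num at this
    rw [this, smul_zero]
  · rw [A.mode_eq_zero (by push_cast at hn ⊢; omega) hu.mem_homog hv, map_zero, map_zero]

/-- The three-point function of two copies of a primary vector of weight two and a word. -/
theorem IsPrimaryTwo.mode_mode_word (hA : A.IsMoonshineType) {u : V} (hu : A.IsPrimaryTwo u)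
    {w : List ℕ} (hw : ∀ a ∈ w, 2 ≤ a) :
    A.mode u 3 (A.mode u (w.sum - 1) (A.word w)) = (chi w : ℂ) • A.mode u 3 u := by
  induction w with
  | nil =>
    have := A.mode_vac_neg_one u
    rw [word, List.sum_nil, Nat.cast_zero, zero_sub]
    simp only [chi, Int.cast_one, one_smul]
    congr 1
  | cons a w ih =>
    have ha : 2 ≤ a := hw a (by simp)
    -- Moving `L_{-a}` to the left of the mode of `u` produces a term killed by the outer `u_(3)`;
    -- the commutator gives the factor `2a + |w| - 2`.
    have h := hu.L_mode (-a) ((a + w.sum : ℕ) - 1) (A.word w)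
    have h3 := hu.mode_three_L_neg hA ha (n := (a + w.sum : ℕ) - 1)
      (by push_cast; ring) (A.word_mem_homog w)
    rw [h, map_add, map_smul, show (-a + ((a + w.sum : ℕ) - 1) : ℤ) = w.sum - 1 by push_cast; ring,
      ih fun b hb => hw b (by simp [hb]), add_eq_zero_iff_eq_neg] at h3
    rw [List.sum_cons, word, h3, smul_smul, ← neg_smul, chi]
    congr 1
    push_cast
    ring

/-- Both sides are linear in `v` and give `z D chi w` times the vacuum on every word `w`. -/
theorem IsPrimaryTwo.eval_smul_mode_mode (hA : A.IsMoonshineType) {u : V} (hu : A.IsPrimaryTwo u)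
    {z : ℂ} (hz : z • A.vac = A.mode u 3 u) {D : List ℤ} {m : ℕ} {X : List (List ℤ × List ℕ)}
    (hX : check D m X = true) {v : V} (hv : v ∈ A.wordSpan m) :
    IntPoly.eval (A.rank / 2) D • A.mode u 3 (A.mode u (m - 1) v) = z • A.lowerSum X v := by
  induction hv using Submodule.span_induction with
  | mem v hv =>
    obtain ⟨w, hw, rfl⟩ := hv
    rw [A.lowerSum_word hX hw, ← hw.2, hu.mode_mode_word hA hw.1, ← hz]
    module
  | zero => simp
  | add v v' _ _ ihv ihv' => simp only [map_add, smul_add, ihv, ihv']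
  | smul c v _ ih =>
    simp only [map_smul]
    rw [smul_comm, ih, smul_comm]

/-- The four-point coefficient `∑ u_(3) u_(m-1) (x_i)_(3-m) y_i` is a rational function of the
central charge if `∑ (x_i)_(3-m) y_i` lies in the Virasoro submodule. -/
theorem IsPrimaryTwo.eval_smul_mode_mode_pairSum (hA : A.IsMoonshineType) {u : V}
    (hu : A.IsPrimaryTwo u) {z : ℂ} (hz : z • A.vac = A.mode u 3 u) {D : List ℤ} {m : ℕ}
    {X : List (List ℤ × List ℕ)} (hX : check D m X = true)
    {ι : Type*} [Fintype ι] {x y : ι → V} (hx : ∀ i, A.IsPrimaryTwo (x i))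
    (hy : ∀ i, A.IsPrimaryTwo (y i)) (hm : A.pairSum x y m ∈ A.virasoroSubmodule) :
    IntPoly.eval (A.rank / 2) D • A.mode u 3 (A.mode u (m - 1) (A.pairSum x y m)) =
      (z * IntPoly.eval (A.rank / 2) (IntPoly.sum (X.map fun t => IntPoly.smul (chi t.2) t.1))) •
        A.pairSum x y 0 := by
  rw [hu.eval_smul_mode_mode hA hz hX (A.mem_wordSpan_of_mem_homog hm (pairSum_mem_homog hx hy m)),
    mul_smul, lowerSum_apply, IntPoly.eval_sum]
  congr 1
  have : ∀ t ∈ X, IntPoly.eval (A.rank / 2) t.1 • A.lower t.2 (A.pairSum x y m) =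
      IntPoly.eval (A.rank / 2) (IntPoly.smul (chi t.2) t.1) • A.pairSum x y 0 := fun t ht => by
    rw [lower_pairSum hx hy (isWord_of_check hX ht), smul_smul, IntPoly.eval_smul, mul_comm]
  rw [List.map_congr_left this, List.map_map]
  generalize X = Y
  induction Y with
  | nil => simp
  | cons t Y ih => simpa [add_smul] using ih

/-! ### Locality of `u` with the two families -/

section locality

variable {ι : Type*} [Fintype ι] {x y : ι → V} {u : V}

theorem IsPrimaryTwo.mode_eq_zero_of_two (hA : A.IsMoonshineType) {u v : V}
    (hu : A.IsPrimaryTwo u) (hv : A.IsPrimaryTwo v) {n : ℤ} (hn : n = 2 ∨ 4 ≤ n) :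
    A.mode u n v = 0 := by
  obtain rfl | hn := hn
  · have := A.mode_mem_homog (k := 1) (n := 2) (by norm_num) hu.mem_homog hv.mem_homog
    rwa [hA.homog_one, Submodule.mem_bot] at this
  · exact A.mode_eq_zero (by push_cast; omega) hu.mem_homog hv.mem_homog

/-- Locality at `(p, q) = (3, -5)`: of the terms with `u` acting first on `y_i`, through `u_(3+j)`,
only `j = 0` survives. -/
theorem IsPrimaryTwo.locality_sum_three (hA : A.IsMoonshineType) (hu : A.IsPrimaryTwo u)
    (hx : ∀ i, A.IsPrimaryTwo (x i)) (hy : ∀ i, A.IsPrimaryTwo (y i)) :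
    A.mode u 3 (A.mode u 7 (A.pairSum x y 8)) - (4 : ℂ) • A.mode u 3 (A.mode u 6 (A.pairSum x y 7)) +
      (6 : ℂ) • A.mode u 3 (A.mode u 5 (A.pairSum x y 6)) -
      (4 : ℂ) • A.mode u 3 (A.mode u 4 (A.pairSum x y 5)) +
      A.mode u 3 (A.mode u 3 (A.pairSum x y 4)) =
    ∑ i, A.mode u 3 (A.mode (x i) (-1) (A.mode u 3 (y i))) := by
  simp only [pairSum, map_sum, Finset.smul_sum, ← Finset.sum_sub_distrib, ← Finset.sum_add_distrib]
  refine Finset.sum_congr rfl fun i _ => ?_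
  have h := congrArg (A.mode u 3) (A.locality hu.mem_homog (hx i).mem_homog 3 (-5) (y i))
  have h4 : ∀ n : ℤ, 4 ≤ n → A.mode u n (y i) = 0 := fun n hn =>
    hu.mode_eq_zero_of_two hA (hy i) (Or.inr hn)
  simp only [Finset.sum_range_succ, Finset.sum_range_zero] at h
  norm_num [h4, Nat.choose, ← Int.cast_smul_eq_zsmul ℂ] at h ⊢
  rw [← sub_eq_zero, ← h]
  module

/-- Locality at `(p, q) = (2, -4)`: now `u_(2) y_i` lies in `V^1 = 0`, so only `j = 1` survives,
with binomial coefficient `-4`. -/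
theorem IsPrimaryTwo.locality_sum_two (hA : A.IsMoonshineType) (hu : A.IsPrimaryTwo u)
    (hx : ∀ i, A.IsPrimaryTwo (x i)) (hy : ∀ i, A.IsPrimaryTwo (y i)) :
    A.mode u 3 (A.mode u 6 (A.pairSum x y 7)) - (4 : ℂ) • A.mode u 3 (A.mode u 5 (A.pairSum x y 6)) +
      (6 : ℂ) • A.mode u 3 (A.mode u 4 (A.pairSum x y 5)) -
      (4 : ℂ) • A.mode u 3 (A.mode u 3 (A.pairSum x y 4)) +
      A.mode u 3 (A.mode u 2 (A.pairSum x y 3)) =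
    (-4 : ℂ) • ∑ i, A.mode u 3 (A.mode (x i) (-1) (A.mode u 3 (y i))) := by
  simp only [pairSum, map_sum, Finset.smul_sum, ← Finset.sum_sub_distrib, ← Finset.sum_add_distrib]
  refine Finset.sum_congr rfl fun i _ => ?_
  have h := congrArg (A.mode u 3) (A.locality hu.mem_homog (hx i).mem_homog 2 (-4) (y i))
  have h4 : ∀ n : ℤ, 4 ≤ n → A.mode u n (y i) = 0 := fun n hn =>
    hu.mode_eq_zero_of_two hA (hy i) (Or.inr hn)
  have h2 : A.mode u 2 (y i) = 0 := hu.mode_eq_zero_of_two hA (hy i) (Or.inl rfl)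
  simp only [Finset.sum_range_succ, Finset.sum_range_zero] at h
  norm_num [h4, h2, Nat.choose, ← Int.cast_smul_eq_zsmul ℂ] at h ⊢
  rw [← sub_eq_zero, ← h]
  module

end locality

/-! ### The bilinear form -/

theorem griessForm_eq_iff (hA : A.IsMoonshineType) {a b : A.Griess} {z : ℂ} :
    griessForm hA a b = z ↔ A.mode a 3 b = z • A.vac := by
  rw [← griessForm_smul_vac hA, (smul_left_injective ℂ A.vac_ne_zero).eq_iff]

/-- The form of the Griess algebra as a bilinear form. -/
noncomputable def griessBilin (hA : A.IsMoonshineType) : LinearMap.BilinForm ℂ A.Griess :=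
  LinearMap.mk₂ ℂ (griessForm hA)
    (fun a a' b => by
      rw [griessForm_eq_iff, add_smul, griessForm_smul_vac, griessForm_smul_vac]
      simp [VertexAlgebra.mode])
    (fun z a b => by
      rw [griessForm_eq_iff, smul_eq_mul, mul_smul, griessForm_smul_vac]
      simp [VertexAlgebra.mode])
    (fun a b b' => by
      rw [griessForm_eq_iff, add_smul, griessForm_smul_vac, griessForm_smul_vac]
      simp)
    (fun z a b => by
      rw [griessForm_eq_iff, smul_eq_mul, mul_smul, griessForm_smul_vac]
      simp)

@[simp] theorem griessBilin_apply (hA : A.IsMoonshineType) (a b : A.Griess) :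
    griessBilin hA a b = griessForm hA a b := rfl

theorem isSymm_griessBilin (hA : A.IsMoonshineType) : (griessBilin hA).IsSymm :=
  ⟨fun a b => by
    simp only [griessBilin_apply]
    rw [griessForm_eq_iff, griessForm_smul_vac, A.mode_three_comm a.2 b.2]⟩

theorem nondegenerate_griessBilin (hA : A.IsMoonshineType) {R : Submodule ℝ A.Griess}
    (hR : A.IsRealForm R) (hpos : IsPosDefOn hA R) : (griessBilin hA).Nondegenerate := by
  have hsep : (griessBilin hA).SeparatingLeft := by
    intro z hz
    obtain ⟨⟨p, q⟩, hpq, -⟩ := hR.existsUnique_add_I_smul z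
    -- Since the form is real on `R`, the real part at `r = p` gives `(p|p) = 0` and the imaginary
    -- part at `r = q` gives `(q|q) = 0`.
    have key : ∀ r ∈ R, griessForm hA p r + Complex.I * griessForm hA q r = 0 := fun r _ => by
      have := hz r
      simp only [hpq] at this
      simpa using this
    have hp : (p : A.Griess) = 0 := by
      by_contra h
      have h1 := congrArg Complex.re (key p p.2)
      have h2 := hpos.im_eq_zero q q.2 p p.2
      have h3 := hpos.re_pos p p.2 h
      simp [h2] at h1
      linarith
    have hq : (q : A.Griess) = 0 := by
      by_contra h
      have h1 := congrArg Complex.im (key q q.2)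
      have h2 := hpos.im_eq_zero p p.2 q q.2
      have h3 := hpos.re_pos q q.2 h
      simp [h2] at h1
      linarith
    rw [hpq]
    simp [hp, hq]
  exact (LinearMap.IsRefl.nondegenerate_iff_separatingLeft (isSymm_griessBilin hA).isRefl).mpr hsep

/-- Commutativity of the Griess algebra. -/
theorem griessMul_comm (hA : A.IsMoonshineType) (a b : A.Griess) :
    A.griessMul a b = A.griessMul b a := by
  refine Subtype.ext ?_
  have h := A.borcherds a b A.vac (-1) 0 1
  rw [finsum_eq_single _ 0, finsum_eq_single _ 0] at h
  · have h1 := A.mode_vac_neg_one (VertexOperator.ncoeff (A.Y a) 1 b)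
    have h2 := A.mode_vac_of_nonneg b 0 le_rfl
    have h3 := A.mode_vac_neg_one a
    simp only [griessMul, VertexAlgebra.mode]
    simpa [h1, h2, h3] using h
  · intro i hi
    have h2 := A.mode_vac_of_nonneg b (0 + i) (by omega)
    have h3 := A.mode_vac_of_nonneg a (-1 + i) (by omega)
    simp only [h2, h3, map_zero, smul_zero, sub_zero]
  · intro i hi
    -- The corrections to commutativity vanish: `a_(2) b` lies in `V^1 = 0`, `a_(3) b` is a multiple
    -- of the vacuum, whose mode `-3` is zero, and higher products have negative weight.
    obtain rfl | rfl | hi : i = 1 ∨ i = 2 ∨ 3 ≤ i := by omega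
    · have h1 : A.mode a 2 b = 0 := by
        have := A.mode_mem_homog (k := 1) (n := 2) (by norm_num) a.2 b.2
        rwa [hA.homog_one, Submodule.mem_bot] at this
      simp only [VertexAlgebra.mode] at h1
      norm_num [h1]
    · have h1 := griessForm_smul_vac hA a b
      have h2 := A.vac_mode (-3) A.vac
      simp only [VertexAlgebra.mode] at h1
      norm_num [← h1] at h2 ⊢
      rw [h2]
      simp
    · have : VertexOperator.ncoeff (A.Y a) (1 + i) b = 0 :=
        A.mode_eq_zero (by push_cast; omega) a.2 b.2
      simp [this]

/-- The conformal vector as an element of the Griess algebra. -/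
def confGriess (A : VertexOperatorAlgebra V) : A.Griess := ⟨A.conf, A.conf_mem_homog⟩

theorem griessForm_conf_conf (hA : A.IsMoonshineType) :
    griessForm hA A.confGriess A.confGriess = A.rank / 2 :=
  (griessForm_eq_iff hA).mpr A.L_two_conf

/-- Half the conformal vector is the unit of the Griess algebra. -/
theorem griessMul_conf (a : A.Griess) : A.griessMul A.confGriess a = (2 : ℂ) • a :=
  Subtype.ext ((A.mem_homog 2 a).mp a.2)

/-- Write `ω = p + iq`. For `r ∈ R` the product `ω r = 2r` is real, so uniqueness forces `q r = 0`.
Then `2q = ω q = pq + i qq = 0` by commutativity. -/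
theorem confGriess_mem_of_isRealForm (hA : A.IsMoonshineType) {R : Submodule ℝ A.Griess}
    (hR : A.IsRealForm R) :
    A.confGriess ∈ R := by
  obtain ⟨⟨p, q⟩, hpq, -⟩ := hR.existsUnique_add_I_smul A.confGriess
  have hmul : ∀ a b c : A.Griess, A.griessMul (a + Complex.I • b) c =
      A.griessMul a c + Complex.I • A.griessMul b c := fun a b c => by
    ext
    simp [griessMul, VertexAlgebra.mode]
  have hqr : ∀ r ∈ R, A.griessMul q r = 0 := fun r hr => by
    have h := griessMul_conf r
    rw [hpq, hmul] at h
    obtain ⟨_, -, huniq⟩ := hR.existsUnique_add_I_smul ((2 : ℂ) • r)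
    have h1 := huniq (⟨_, hR.mul_mem p p.2 r hr⟩, ⟨_, hR.mul_mem q q.2 r hr⟩) h.symm
    have h2 := huniq (⟨(2 : ℝ) • r, R.smul_mem _ hr⟩, 0) (by
      simp only [Submodule.coe_zero, smul_zero, add_zero]
      rw [← Complex.coe_smul (2 : ℝ) r]
      norm_num)
    have h3 := congrArg (fun s : R × R => (s.2 : A.Griess)) (h1.trans h2.symm)
    simpa using h3
  have hq : (q : A.Griess) = 0 := by
    have h := hmul p q q
    rw [← hpq, griessMul_conf, griessMul_comm hA p q, hqr p p.2, hqr q q.2] at h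
    simpa using h
  rw [hpq, hq]
  simp

end VertexOperatorAlgebra

/-- For dual bases `b`, `b'` with respect to a symmetric form, `∑ b_i ⊗ b'_i` is invariant under
isometries. -/
theorem LinearMap.BilinForm.sum_dualBasis_map {K W M ι : Type*} [Field K] [AddCommGroup W]
    [Module K W] [AddCommGroup M] [Module K M] [Fintype ι] [DecidableEq ι]
    {F : LinearMap.BilinForm K W} (hF : F.Nondegenerate) (hs : F.IsSymm) (b : Module.Basis ι K W)
    {T T' : W →ₗ[K] W} (hadj : ∀ x y, F (T x) y = F x (T' y)) (hT : ∀ y, T (T' y) = y)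
    (f : W →ₗ[K] W →ₗ[K] M) :
    ∑ i, f (T (b i)) (T (F.dualBasis hF b i)) = ∑ i, f (b i) (F.dualBasis hF b i) := by
  set y := F.dualBasis hF b
  have h1 : ∀ z, z = ∑ i, F z (b i) • y i := fun z => by
    simpa [y] using (y.sum_repr z).symm
  have h2 : ∀ z, z = ∑ i, F z (y i) • b i := fun z => by
    conv_lhs => rw [← b.sum_repr z]
    refine Finset.sum_congr rfl fun i _ => ?_
    congr 1
    conv_rhs => rw [← b.sum_repr z]
    simp only [y, map_sum, map_smul, LinearMap.sum_apply, LinearMap.smul_apply,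
      LinearMap.BilinForm.apply_dualBasis_right hF hs]
    simp
  calc ∑ i, f (T (b i)) (T (y i))
      = ∑ i, ∑ j, F (T (b i)) (y j) • f (b j) (T (y i)) := by
        refine Finset.sum_congr rfl fun i _ => ?_
        conv_lhs => rw [h2 (T (b i))]
        simp
    _ = ∑ j, f (b j) (T (∑ i, F (T' (y j)) (b i) • y i)) := by
        rw [Finset.sum_comm]
        refine Finset.sum_congr rfl fun j _ => ?_
        simp only [map_sum, map_smul]
        refine Finset.sum_congr rfl fun i _ => ?_
        rw [hadj, hs.eq]
    _ = ∑ j, f (b j) (y j) := by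
        refine Finset.sum_congr rfl fun j _ => ?_
        rw [← h1, hT]

namespace VertexOperatorAlgebra

open VirasoroWord

variable {V : Type*} [AddCommGroup V] [Module ℂ V] {A : VertexOperatorAlgebra V}

/-! ### Automorphisms -/

theorem aut_vac {g : V ≃ₗ[ℂ] V} (hg : g ∈ A.aut) : g A.vac = A.vac := by
  have h1 := hg.1 A.vac (g.symm A.vac) (-1)
  rw [LinearEquiv.apply_symm_apply] at h1
  have h2 : A.mode (g A.vac) (-1) A.vac = g A.vac := A.mode_vac_neg_one _
  have h3 : A.mode A.vac (-1) (g.symm A.vac) = g.symm A.vac := by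
    have := A.vac_mode (-1) (g.symm A.vac)
    rwa [if_pos rfl] at this
  rw [h2, h3, LinearEquiv.apply_symm_apply] at h1
  exact h1.symm

theorem aut_mem_homog {g : V ≃ₗ[ℂ] V} (hg : g ∈ A.aut) {n : ℕ} {v : V} (hv : v ∈ A.homog n) :
    g v ∈ A.homog n := by
  rw [mem_homog] at hv ⊢
  have := hg.1 A.conf v 1
  rw [hg.2, hv, map_smul] at this
  exact this.symm

/-- The action of an automorphism on the Griess algebra. -/
def autGriess {g : V ≃ₗ[ℂ] V} (hg : g ∈ A.aut) : A.Griess →ₗ[ℂ] A.Griess :=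
  (g : V →ₗ[ℂ] V).restrict fun _ hv => aut_mem_homog hg hv

theorem griessForm_autGriess (hA : A.IsMoonshineType) {g : V ≃ₗ[ℂ] V} (hg : g ∈ A.aut)
    (a b : A.Griess) :
    griessForm hA (autGriess hg a) (autGriess hg b) = griessForm hA a b := by
  rw [griessForm_eq_iff]
  change A.mode (g a) 3 (g b) = _
  rw [← hg.1, ← griessForm_smul_vac hA, map_smul, aut_vac hg]

/-- The subspace of the Griess algebra orthogonal to the conformal vector. -/
noncomputable def primaryGriess (hA : A.IsMoonshineType) : Submodule ℂ A.Griess :=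
  (griessBilin hA).orthogonal (ℂ ∙ A.confGriess)

theorem mem_primaryGriess (hA : A.IsMoonshineType) {x : A.Griess} :
    x ∈ primaryGriess hA ↔ griessForm hA A.confGriess x = 0 := by
  rw [primaryGriess, LinearMap.BilinForm.mem_orthogonal_iff]
  constructor
  · exact fun h => h _ (Submodule.mem_span_singleton_self _)
  · intro h y hy
    obtain ⟨z, rfl⟩ := Submodule.mem_span_singleton.mp hy
    simp [h]

theorem isPrimaryTwo_of_mem_primaryGriess (hA : A.IsMoonshineType) {x : A.Griess}
    (hx : x ∈ primaryGriess hA) : A.IsPrimaryTwo (x : V) where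
  mem_homog := x.2
  L_one := by
    have := A.L_mem_homog (n := 1) (j := 1) (by norm_num) x.2
    rwa [hA.homog_one, Submodule.mem_bot] at this
  L_two := by
    have := griessForm_smul_vac hA A.confGriess x
    rw [(mem_primaryGriess hA).mp hx, zero_smul] at this
    exact this.symm

/-- The action of an automorphism on the orthogonal complement of the conformal vector. -/
noncomputable def autPrimary (hA : A.IsMoonshineType) {g : V ≃ₗ[ℂ] V} (hg : g ∈ A.aut) :
    primaryGriess hA →ₗ[ℂ] primaryGriess hA :=
  (autGriess hg).restrict fun x hx => by
    have h : autGriess hg A.confGriess = A.confGriess := Subtype.ext hg.2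
    rw [mem_primaryGriess] at hx ⊢
    rw [← h, griessForm_autGriess, hx]

/-- `(a, b) ↦ a_(k) b` as a bilinear map on the orthogonal complement of the conformal vector. -/
noncomputable def modePrimary (hA : A.IsMoonshineType) (k : ℤ) :
    primaryGriess hA →ₗ[ℂ] primaryGriess hA →ₗ[ℂ] V :=
  LinearMap.mk₂ ℂ (fun x y => A.mode (x : A.Griess) k (y : A.Griess))
    (fun _ _ _ => by simp [VertexAlgebra.mode]) (fun _ _ _ => by simp [VertexAlgebra.mode])
    (fun _ _ _ => by simp) (fun _ _ _ => by simp)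

/-- There are dual bases of the primary vectors of weight two, and a primary vector of weight two
of nonzero norm. -/
theorem exists_dual_primary (hA : A.IsMoonshineType) (hB : (griessBilin hA).Nondegenerate)
    (hc : A.rank ≠ 0) (hd : 2 ≤ Module.finrank ℂ A.Griess) :
    ∃ (n : ℕ) (x y : Fin n → V) (u : V) (z : ℂ), n + 1 = Module.finrank ℂ A.Griess ∧
      (∀ i, A.IsPrimaryTwo (x i)) ∧ (∀ i, A.IsPrimaryTwo (y i)) ∧ A.IsPrimaryTwo u ∧
      z ≠ 0 ∧ z • A.vac = A.mode u 3 u ∧ A.pairSum x y 0 = (n : ℂ) • A.vac ∧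
      ∑ i, A.mode u 3 (A.mode (x i) (-1) (A.mode u 3 (y i))) = z • A.vac ∧
      ∀ g ∈ A.aut, ∀ m, g (A.pairSum x y m) = A.pairSum x y m := by
  have : FiniteDimensional ℂ A.Griess := A.finiteDimensional_eigenspace 2
  have hconf : griessBilin hA A.confGriess A.confGriess ≠ 0 := by
    rw [griessBilin_apply, griessForm_conf_conf]
    exact div_ne_zero hc two_ne_zero
  have hF := LinearMap.BilinForm.restrict_nondegenerate_orthogonal_spanSingleton _ hB
    (isSymm_griessBilin hA).isRefl hconf
  have hs := (isSymm_griessBilin hA).restrict (primaryGriess hA)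
  have hrank : Module.finrank ℂ (primaryGriess hA) + 1 = Module.finrank ℂ A.Griess := by
    rw [primaryGriess, LinearMap.BilinForm.finrank_orthogonal hB, finrank_span_singleton]
    · omega
    · rintro h
      simp [h] at hconf
  change ((griessBilin hA).restrict (primaryGriess hA)).Nondegenerate at hF
  set F := (griessBilin hA).restrict (primaryGriess hA)
  have hFvac : ∀ a b : primaryGriess hA,
      A.mode (a : A.Griess) 3 (b : A.Griess) = F a b • A.vac := fun a b =>
    (griessForm_smul_vac hA a b).symm
  have hprim : ∀ a : primaryGriess hA, A.IsPrimaryTwo ((a : A.Griess) : V) := fun a =>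
    isPrimaryTwo_of_mem_primaryGriess hA a.2
  have : Nontrivial (primaryGriess hA) :=
    Module.nontrivial_of_finrank_pos (R := ℂ) (by omega)
  have : Invertible (2 : ℂ) := invertibleOfNonzero two_ne_zero
  -- Nonzero because `d ≥ 2` leaves a nontrivial complement; polarization then yields a vector of
  -- nonzero norm.
  obtain ⟨u, hu⟩ := LinearMap.BilinForm.exists_bilinForm_self_ne_zero hF.ne_zero ⟨hs.eq⟩
  let b := Module.finBasis ℂ (primaryGriess hA)
  refine ⟨_, fun i => (b i : A.Griess), fun i => (F.dualBasis hF b i : A.Griess), (u : A.Griess),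
    F u u, hrank, fun i => hprim _, fun i => hprim _, hprim _, hu, (hFvac u u).symm, ?_, ?_, ?_⟩
  · rw [pairSum]
    simp only [Nat.cast_zero, sub_zero, hFvac, LinearMap.BilinForm.apply_dualBasis_right hF hs]
    simp [← Nat.cast_smul_eq_nsmul ℂ]
  · have h1 : ∀ i, A.mode (b i : A.Griess) (-1) A.vac = (b i : A.Griess) := fun i =>
      A.mode_vac_neg_one _
    simp only [hFvac, map_smul, h1, smul_smul, ← Finset.sum_smul]
    -- The sum is `∑ (u|x_i)(u|y_i)`, which is `(u|u)` by expanding one `u` in the dual basis.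
    have h2 := congrArg (F u) ((F.dualBasis hF b).sum_repr u)
    simp only [map_sum, map_smul, LinearMap.BilinForm.dualBasis_repr_apply, smul_eq_mul] at h2
    rw [← h2]
    exact congrArg (· • A.vac) (Finset.sum_congr rfl fun i _ => mul_comm _ _)
  · intro g hg m
    have hg' := A.aut.inv_mem hg
    have := LinearMap.BilinForm.sum_dualBasis_map hF hs b (T := autPrimary hA hg)
      (T' := autPrimary hA hg') (fun x y => ?_) (fun y => ?_) (modePrimary hA (3 - m))
    · rw [pairSum, map_sum]
      simp only [hg.1]
      exact this
    · have h := griessForm_autGriess hA hg x (autPrimary hA hg' y : primaryGriess hA)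
      rw [← griessBilin_apply, ← griessBilin_apply] at h
      change _ = F x (autPrimary hA hg' y) at h
      rw [← h]
      change griessBilin hA _ _ = _
      congr 1
      exact Subtype.ext (g.apply_symm_apply _).symm
    · exact Subtype.ext (Subtype.ext (g.apply_symm_apply _))

/-! ### Certificates for the expansion of the three-point function -/

/-- Coefficients of the polynomial `kacD8 (2 h)` in `h`. -/
def kacPoly : List ℤ := [0, -412896, -51280, 5648768, 4398352, 992800, 67200]

/-- Coefficients, in weights three to eight, of the operators in the positive part of the Virasoro
algebra which represent the functional `L_{-a} w ↦ (m + a - 2) w` on the vacuum module. -/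
def cert : ℕ → List (List ℤ × List ℕ)
  | 3 => [([-412896, -51280, 5648768, 4398352, 992800, 67200], [3])]
  | 4 => [([0, -112608, 37200, 1523664, 506976, 40320], [4]),
      ([-412896, 136400, 5586768, 1858912, 147840], [2, 2])]
  | 5 => [([0, -75072, 24800, 1015776, 337984, 26880], [5]),
      ([-412896, 136400, 5586768, 1858912, 147840], [3, 2])]
  | 6 => [([0, -503424, -1589184, 360640, 220160, 19200], [6]),
      ([-412896, -958768, 1656464, 908576, 88320], [4, 2]),
      ([0, 376464, 1389544, 460040, 37200], [3, 3]),
      ([0, 273792, 948352, 119040], [2, 2, 2])]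
  | 7 => [([0, -377568, -1191888, 270480, 165120, 14400], [7]),
      ([-412896, -1095664, 1113840, 611968, 58560], [5, 2]),
      ([0, 205344, 813936, 444912, 44640], [4, 3]),
      ([0, 410688, 1422528, 178560], [3, 2, 2])]
  | 8 => [([0, -579696, -1197464, 154360, 120960, 11200], [8]),
      ([-412896, -1479280, 131632, 390400, 41600], [6, 2]),
      ([0, 576, 549952, 297904, 29680], [5, 3]),
      ([0, 181872, 61704, 100824, 13440], [4, 4]),
      ([0, -128256, 593600, 106240], [4, 2, 2]),
      ([0, 300768, 696592, 89840], [3, 3, 2]),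
      ([0, 61664, 78720], [2, 2, 2, 2])]
  | _ => []

/-- With denominators cleared by `D_8`, this is an identity of integer coefficient lists for the
finitely many words of weight `m`. -/
theorem check_cert {m : ℕ} (h3 : 3 ≤ m) (h8 : m ≤ 8) : check kacPoly m (cert m) = true := by
  interval_cases m <;> decide +kernel

theorem eval_kacPoly (c : ℂ) : IntPoly.eval (c / 2) kacPoly = kacD8 c := by
  simp only [kacPoly, IntPoly.eval_cons, IntPoly.eval_nil, kacD8]
  push_cast
  ring

/-- The two relations between the central charge and the number of primary vectors of weight two
which locality imposes. -/
theorem locality_relations (hA : A.IsMoonshineType) (hS : A.IsClassS 8)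
    (hB : (griessBilin hA).Nondegenerate) (hc : A.rank ≠ 0)
    (hd : 2 ≤ Module.finrank ℂ A.Griess) :
    ∃ n : ℕ, n + 1 = Module.finrank ℂ A.Griess ∧
      n * (A.rank * (206448 + 42460 * A.rank - 14598 * A.rank ^ 2 + 1008 * A.rank ^ 3 -
        20 * A.rank ^ 4)) = kacD8 A.rank ∧
      n * (A.rank * (825792 + 1369456 * A.rank - 14296 * A.rank ^ 2 - 4688 * A.rank ^ 3 +
        120 * A.rank ^ 4)) = 4 * kacD8 A.rank := by
  obtain ⟨n, x, y, u, z, hn, hx, hy, hu, hz, huu, h0, htr, hinv⟩ :=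
    exists_dual_primary hA hB hc hd
  refine ⟨n, hn, ?_⟩
  -- The sole use of class `S^8`: the pair sums are fixed by `Aut V`.
  have hmem : ∀ m ≤ 8, A.pairSum x y m ∈ A.virasoroSubmodule := fun m hm =>
    hS _ (Submodule.mem_iSup_of_mem m (Submodule.mem_iSup_of_mem hm (pairSum_mem_homog hx hy m)))
      fun g hg => by simp [hinv g hg m]
  have key : ∀ m : ℕ, 3 ≤ m → m ≤ 8 →
      kacD8 A.rank • A.mode u 3 (A.mode u (m - 1) (A.pairSum x y m)) =
      (z * IntPoly.eval (A.rank / 2)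
        (IntPoly.sum ((cert m).map fun t => IntPoly.smul (chi t.2) t.1)) * n) • A.vac :=
    fun m h3 h8 => by
      rw [← eval_kacPoly,
        hu.eval_smul_mode_mode_pairSum hA huu (check_cert h3 h8) hx hy (hmem m h8), h0, smul_smul]
  have e3 := key 3 (by norm_num) (by norm_num)
  have e4 := key 4 (by norm_num) (by norm_num)
  have e5 := key 5 (by norm_num) (by norm_num)
  have e6 := key 6 (by norm_num) (by norm_num)
  have e7 := key 7 (by norm_num) (by norm_num)
  have e8 := key 8 (by norm_num) (by norm_num)
  norm_num [cert, chi, IntPoly.sum, IntPoly.smul, IntPoly.add] at e3 e4 e5 e6 e7 e8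
  have l3 := hu.locality_sum_three hA hx hy
  have l2 := hu.locality_sum_two hA hx hy
  rw [htr] at l3 l2
  have inj := smul_left_injective ℂ A.vac_ne_zero
  constructor
  · refine mul_left_cancel₀ hz (inj ?_)
    have := congrArg (kacD8 A.rank • ·) l3
    simp only [smul_add, smul_sub, smul_comm _ (4 : ℂ), smul_comm _ (6 : ℂ), e4, e5, e6, e7,
      e8] at this
    simp only [smul_smul, ← add_smul, ← sub_smul] at this
    rw [mul_comm z (kacD8 A.rank)]
    simp only
    rw [← this]
    congr 1
    ring
  · refine mul_left_cancel₀ hz (inj ?_)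
    have := congrArg (kacD8 A.rank • ·) l2
    simp only [smul_add, smul_sub, smul_comm _ (4 : ℂ), smul_comm _ (6 : ℂ), e3, e4, e5, e6,
      e7] at this
    simp only [smul_smul, ← add_smul, ← sub_smul] at this
    refine neg_injective ?_
    simp only [← neg_smul]
    rw [show -(z * (4 * kacD8 A.rank)) = kacD8 A.rank * (-4 * z) by ring, ← this]
    congr 1
    ring

theorem exists_rank_eq_ofReal (hA : A.IsMoonshineType) {R : Submodule ℝ A.Griess}
    (hR : A.IsRealForm R) (hpos : IsPosDefOn hA R) : ∃ r : ℝ, 0 < r ∧ A.rank = r := by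
  have hmem := confGriess_mem_of_isRealForm hA hR
  have hne : A.confGriess ≠ 0 := fun h => A.conf_ne_zero (congrArg Subtype.val h)
  have h1 := hpos.im_eq_zero _ hmem _ hmem
  have h2 := hpos.re_pos _ hmem hne
  rw [griessForm_conf_conf] at h1 h2
  simp at h1 h2
  exact ⟨A.rank.re, h2, Complex.ext rfl h1⟩

end VertexOperatorAlgebra

/-! ### Solving for the central charge and the dimension -/

theorem mainTheorem4 {V : Type*} [AddCommGroup V] [Module ℂ V]
    (A : VertexOperatorAlgebra V) (hA : A.IsMoonshineType)
    (hS : A.IsClassS 8) (hD : kacD8 A.rank ≠ 0)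
    (hR : ∃ R : Submodule ℝ A.Griess,
      A.IsRealForm R ∧ VertexOperatorAlgebra.IsPosDefOn hA R)
    (hd : 2 ≤ Module.finrank ℂ A.Griess) :
    A.rank = 24 ∧ Module.finrank ℂ A.Griess = 196884 := by
  obtain ⟨R, hR, hpos⟩ := hR
  obtain ⟨r, hr0, hr⟩ := VertexOperatorAlgebra.exists_rank_eq_ofReal hA hR hpos
  obtain ⟨n, hn, e1, e2⟩ := VertexOperatorAlgebra.locality_relations hA hS
    (VertexOperatorAlgebra.nondegenerate_griessBilin hA hR hpos)
    (by rw [hr]; exact_mod_cast hr0.ne') hd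
  rw [← hn]
  rw [hr] at hD e1 e2 ⊢
  rw [kacD8] at hD e1 e2
  norm_cast at hD e1 e2 ⊢
  have hn0 : (n : ℝ) ≠ 0 := fun h => hD (by rw [← e1, h, zero_mul])
  have hfac : (r - 24) * (5 * r - 142) = 0 := by
    have : (n : ℝ) * r ^ 2 * (5 * r + 44) * ((r - 24) * (5 * r - 142)) = 0 := by
      -- This combination cancels `D_8`; the cofactor is nonzero since `r > 0` and `n ≠ 0`.
      linear_combination (-1 / 2 : ℝ) * e1 + (1 / 8 : ℝ) * e2
    exact (mul_eq_zero.mp this).resolve_left (by positivity)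
  rcases mul_eq_zero.mp hfac with h | h
  · obtain rfl : r = 24 := by linarith
    norm_num at e1
    have : (n : ℝ) = 196883 := by linarith
    have : n = 196883 := by exact_mod_cast this
    exact ⟨rfl, by omega⟩
  · obtain rfl : r = 142 / 5 := by linarith
    -- At `c = 142/5` the coefficient of `n` is negative while `D_8` is positive.
    norm_num at e2
    have : (0 : ℝ) ≤ n := n.cast_nonneg
    linarith
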